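/- There is an absolute constant $c>0$ such that for every finite set $A\subset\mathbb{R}\setminus\{0\}$ with $|A|\ge 2$, $$|AA-AA|\;\ge\; c\,\frac{|A|^{26/17}}{\log^{2/17}|A|},$$ where $AA-AA=\{a_1a_2-a_3a_4 : a_1,a_2,a_3,a_4\in A\}$ and $\log^{2/17}|A|=(\log|A|)^{2/17}$. -/

import Mathlib

open scoped Pointwise

/-! Write N, M, D, D' for the sizes of A, AA, A-A, AA-AA. Three inequalities combine.

Incidences: the lines y = cu - x with c in A, x in AA each meet A × (AA-AA) in N points, so N²M ≪
D'² (`card_sq_mul_card_mul_le`).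

Energies: applied to the lines y = c(u + x), the same bound controls how many x have many
representations in A-B. Hence E₃(A) ≪ N M² log N and E(A,B)² ≪ |B|³M². The Schoen–Shkredov
inequality N⁸ ≪ D E₃(A) E(A, A-A) (`card_pow_eight_le`) then gives N¹⁴ ≪ D⁵M⁶ log² N.

Dilation: D ≤ D'. Multiplying by N¹² yields N²⁶ ≪ D⁵(N²M)⁶ log² N ≪ D'¹⁷ log² N. -/

/-! ### Incidences between lines and Cartesian products -/

/-- Choose one representative in each colour class; every other element collides with its
representative. -/
theorem card_le_card_image_add_card_collisions {α β : Type*} [DecidableEq α] [DecidableEq β]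
    (T : Finset α) (c : α → β) :
    T.card ≤ (T.image c).card + (T.offDiag.filter fun p => c p.1 = c p.2).card := by
  rcases T.eq_empty_or_nonempty with rfl | ⟨x₀, -⟩
  · simp
  have : Nonempty α := ⟨x₀⟩
  have hc : ∀ y ∈ T.image c, ∃ x ∈ T, c x = y := fun y hy => by simpa using hy
  choose! g hgT hg using hc
  set S := (T.image c).image g
  have h1 : T.card ≤ S.card + (T \ S).card := by
    have := Finset.le_card_sdiff S T
    omega
  have h2 : (T \ S).card ≤ (T.offDiag.filter fun p => c p.1 = c p.2).card := by
    refine Finset.card_le_card_of_injOn (fun u => (u, g (c u))) ?_ ?_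
    · intro u hu
      have hu' := Finset.mem_sdiff.1 (Finset.mem_coe.1 hu)
      have hcu : c u ∈ T.image c := Finset.mem_image_of_mem c hu'.1
      simp only [Finset.coe_filter, Finset.mem_offDiag, Set.mem_ofPred_eq]
      refine ⟨⟨hu'.1, hgT _ hcu, fun h => hu'.2 ?_⟩, (hg _ hcu).symm⟩
      rw [h]
      exact Finset.mem_image_of_mem g hcu
    · intro u _ v _ h
      exact (Prod.ext_iff.1 h).1
  exact h1.trans (add_le_add Finset.card_image_le h2)

/-- The index of the block of `k` consecutive elements of `U` in which `x` falls. -/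
noncomputable def rankBlock (U : Finset ℝ) (k : ℕ) (x : ℝ) : ℕ := (U.filter (· < x)).card / k

theorem rankBlock_mono (U : Finset ℝ) (k : ℕ) : Monotone (rankBlock U k) := fun _ _ h =>
  Nat.div_le_div_right (Finset.card_le_card
    (Finset.monotone_filter_right U fun _ _ hu => lt_of_lt_of_le hu h))

theorem rankBlock_le (U : Finset ℝ) (k : ℕ) (x : ℝ) : rankBlock U k x ≤ U.card / k :=
  Nat.div_le_div_right (Finset.card_le_card (Finset.filter_subset _ _))

theorem strictMonoOn_rank (U : Finset ℝ) :
    StrictMonoOn (fun x => (U.filter (· < x)).card) (U : Set ℝ) := by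
  intro x hx y _ hxy
  refine Finset.card_lt_card ⟨Finset.monotone_filter_right U fun _ _ hu => lt_trans hu hxy, ?_⟩
  intro h
  have := h (Finset.mem_filter.2 ⟨hx, hxy⟩)
  simp at this

theorem card_rankBlock_fiber_le (U : Finset ℝ) {k : ℕ} (hk : 0 < k) (q : ℕ) :
    (U.filter fun u => rankBlock U k u = q).card ≤ k := by
  have : (U.filter fun u => rankBlock U k u = q).card ≤ (Finset.Ico (k * q) (k * q + k)).card := by
    refine Finset.card_le_card_of_injOn (fun x => (U.filter (· < x)).card) ?_ ?_
    · intro u hu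
      have h := (Finset.mem_filter.1 (Finset.mem_coe.1 hu)).2
      simp only [rankBlock] at h
      simp only [Finset.coe_Ico, Set.mem_Ico]
      have h1 := Nat.div_add_mod (U.filter (· < u)).card k
      have h2 := Nat.mod_lt (U.filter (· < u)).card hk
      rw [h] at h1
      omega
    · exact (strictMonoOn_rank U).injOn.mono (fun _ hu => (Finset.mem_filter.1 hu).1)
  simpa using this

/-- Along a line both block indices are monotone in x. Their sum, with the second index reversed
when the slope is negative, therefore determines both, so the line crosses few cells. -/
theorem exists_cell_index (U V : Finset ℝ) (k k' : ℕ) {a : ℝ} (ha : a ≠ 0) (b : ℝ) :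
    ∃ c : ℝ → ℕ, (∀ x, c x < U.card / k + V.card / k' + 1) ∧
      ∀ x y, c x = c y → rankBlock U k x = rankBlock U k y ∧
        rankBlock V k' (a * x + b) = rankBlock V k' (a * y + b) := by
  rcases lt_or_gt_of_ne ha with ha | ha
  · refine ⟨fun x => rankBlock U k x + (V.card / k' - rankBlock V k' (a * x + b)), ?_, ?_⟩
    · intro x
      have := rankBlock_le U k x
      dsimp only
      generalize U.card / k = p at *
      generalize V.card / k' = q at *
      omega
    · intro x y h
      have hx := rankBlock_le V k' (a * x + b)
      have hy := rankBlock_le V k' (a * y + b)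
      dsimp only at h
      rcases le_total x y with hxy | hxy
      · have h1 := rankBlock_mono U k hxy
        have h2 := rankBlock_mono V k' (show a * y + b ≤ a * x + b by nlinarith)
        omega
      · have h1 := rankBlock_mono U k hxy
        have h2 := rankBlock_mono V k' (show a * x + b ≤ a * y + b by nlinarith)
        omega
  · refine ⟨fun x => rankBlock U k x + rankBlock V k' (a * x + b), ?_, ?_⟩
    · intro x
      have := rankBlock_le U k x
      have := rankBlock_le V k' (a * x + b)
      dsimp only
      omega
    · intro x y h
      dsimp only at h
      rcases le_total x y with hxy | hxy
      · have h1 := rankBlock_mono U k hxy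
        have h2 := rankBlock_mono V k' (show a * x + b ≤ a * y + b by nlinarith)
        omega
      · have h1 := rankBlock_mono U k hxy
        have h2 := rankBlock_mono V k' (show a * y + b ≤ a * x + b by nlinarith)
        omega

/-- Counting pairs of points of `U × V` that lie on a common line and in a common cell. -/
theorem card_lines_mul_le (U V : Finset ℝ) (L : Finset (ℝ × ℝ)) {t k k' : ℕ}
    (hk : 0 < k) (hk' : 0 < k') (hL : ∀ l ∈ L, l.1 ≠ 0)
    (ht : ∀ l ∈ L, t ≤ (U.filter fun u => l.1 * u + l.2 ∈ V).card) :
    L.card * (t - (U.card / k + V.card / k' + 1)) ≤ U.card * V.card * (k * k') := by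
  set Q : ℝ × ℝ → Finset (ℝ × ℝ) := fun l =>
    (U.filter fun u => l.1 * u + l.2 ∈ V).offDiag.filter fun p =>
      rankBlock U k p.1 = rankBlock U k p.2 ∧
        rankBlock V k' (l.1 * p.1 + l.2) = rankBlock V k' (l.1 * p.2 + l.2) with hQ
  have hQcard : ∀ l ∈ L, t - (U.card / k + V.card / k' + 1) ≤ (Q l).card := by
    intro l hl
    obtain ⟨c, hc, hcell⟩ := exists_cell_index U V k k' (hL l hl) l.2
    set T := U.filter fun u => l.1 * u + l.2 ∈ V with hT
    have h1 := card_le_card_image_add_card_collisions T c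
    have h2 : (T.image c).card ≤ U.card / k + V.card / k' + 1 := by
      rw [← Finset.card_range (U.card / k + V.card / k' + 1)]
      refine Finset.card_le_card fun y hy => ?_
      obtain ⟨x, -, rfl⟩ := Finset.mem_image.1 hy
      exact Finset.mem_range.2 (hc x)
    have h3 : (T.offDiag.filter fun p => c p.1 = c p.2).card ≤ (Q l).card :=
      Finset.card_le_card (Finset.monotone_filter_right _ fun p _ hp => hcell _ _ hp)
    have : t ≤ T.card := ht l hl
    generalize U.card / k + V.card / k' + 1 = q at *
    omega
  set R : ℝ × ℝ → Finset (ℝ × ℝ) := fun p =>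
    (U.filter fun u => rankBlock U k u = rankBlock U k p.1) ×ˢ
      (V.filter fun v => rankBlock V k' v = rankBlock V k' p.2) with hR
  -- Two points with distinct abscissas determine their line, so a pair of points in one cell is
  -- counted for at most one line.
  have hinj : (L.sigma Q).card ≤ ((U ×ˢ V).sigma R).card := by
    refine Finset.card_le_card_of_injOn
      (fun x => ⟨(x.2.1, x.1.1 * x.2.1 + x.1.2), (x.2.2, x.1.1 * x.2.2 + x.1.2)⟩) ?_ ?_
    · rintro ⟨l, p⟩ hx
      simp only [Finset.mem_coe, Finset.mem_sigma, hQ, Finset.mem_filter, Finset.mem_offDiag] at hx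
      simp only [Finset.mem_coe, Finset.mem_sigma, hR, Finset.mem_filter, Finset.mem_product]
      tauto
    · rintro ⟨⟨a, b⟩, ⟨u, u'⟩⟩ hx ⟨⟨a', b'⟩, ⟨w, w'⟩⟩ - h
      simp only [Finset.mem_coe, Finset.mem_sigma, hQ, Finset.mem_filter, Finset.mem_offDiag] at hx
      simp only [Sigma.mk.injEq, Prod.mk.injEq, heq_eq_eq] at h
      obtain ⟨⟨rfl, h1⟩, rfl, h2⟩ := h
      have hne : u - u' ≠ 0 := sub_ne_zero.2 hx.2.1.2.2
      have haa : a = a' := by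
        have : (a - a') * (u - u') = 0 := by linear_combination h1 - h2
        rcases mul_eq_zero.1 this with h | h
        · linarith
        · exact absurd h hne
      subst haa
      have : b = b' := by linarith
      subst this
      rfl
  calc L.card * (t - (U.card / k + V.card / k' + 1)) ≤ (L.sigma Q).card := by
        rw [Finset.card_sigma, ← smul_eq_mul]
        exact Finset.card_nsmul_le_sum _ _ _ hQcard
    _ ≤ ((U ×ˢ V).sigma R).card := hinj
    _ ≤ U.card * V.card * (k * k') := by
        rw [Finset.card_sigma, ← Finset.card_product, ← smul_eq_mul]
        refine Finset.sum_le_card_nsmul _ _ _ fun p _ => ?_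
        rw [Finset.card_product]
        exact Nat.mul_le_mul (card_rankBlock_fiber_le U hk _) (card_rankBlock_fiber_le V hk' _)

/-- A Szemerédi–Trotter bound for lines that are rich in points of a Cartesian product. -/
theorem card_rich_lines_le (U V : Finset ℝ) (L : Finset (ℝ × ℝ)) {t : ℕ} (ht2 : 2 ≤ t)
    (hL : ∀ l ∈ L, l.1 ≠ 0)
    (ht : ∀ l ∈ L, t ≤ (U.filter fun u => l.1 * u + l.2 ∈ V).card) :
    L.card * t ^ 3 ≤ 324 * (U.card ^ 2 * V.card ^ 2) := by
  rcases L.eq_empty_or_nonempty with rfl | ⟨l, hl⟩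
  · simp
  have hU : t ≤ U.card := (ht l hl).trans (Finset.card_le_card (Finset.filter_subset _ _))
  have hV : t ≤ V.card := (ht l hl).trans <| by
    refine Finset.card_le_card_of_injOn (fun u => l.1 * u + l.2) ?_ ?_
    · intro u hu
      exact (Finset.mem_filter.1 (Finset.mem_coe.1 hu)).2
    · intro u _ v _ h
      exact mul_left_cancel₀ (hL l hl) (add_right_cancel h)
  set m := U.card
  set n := V.card
  -- Blocks of length about 8m/t: few enough that a line meets at most t/4 + 1 cells, short enough
  -- that t · k ≤ 9m.
  have hblock : ∀ m : ℕ, t ≤ m → 8 * (m / (8 * m / t + 1)) ≤ t ∧ t * (8 * m / t + 1) ≤ 9 * m := by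
    intro m hm
    have h1 : 8 * m < t * (8 * m / t + 1) := Nat.lt_mul_div_succ _ (by omega)
    have h2 : t * (8 * m / t) ≤ 8 * m := Nat.mul_div_le _ _
    refine ⟨?_, by rw [mul_add]; omega⟩
    have h3 := Nat.div_mul_le_self m (8 * m / t + 1)
    by_contra! hcon
    nlinarith [Nat.zero_le (8 * m / t)]
  obtain ⟨hm1, hm2⟩ := hblock m hU
  obtain ⟨hn1, hn2⟩ := hblock n hV
  have main := card_lines_mul_le U V L (t := t) (Nat.succ_pos (8 * m / t))
    (Nat.succ_pos (8 * n / t)) hL ht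
  simp only [Nat.succ_eq_add_one] at main
  set k := 8 * m / t + 1
  set k' := 8 * n / t + 1
  -- The extra 1 in the cell count is absorbed because t ≥ 2.
  have h4 : t ≤ 4 * (t - (m / k + n / k' + 1)) := by omega
  calc L.card * t ^ 3 = L.card * t * t ^ 2 := by ring
    _ ≤ L.card * (4 * (t - (m / k + n / k' + 1))) * t ^ 2 := by gcongr
    _ = 4 * (L.card * (t - (m / k + n / k' + 1))) * t ^ 2 := by ring
    _ ≤ 4 * (m * n * (k * k')) * t ^ 2 := by gcongr
    _ = 4 * (m * n) * ((t * k) * (t * k')) := by ring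
    _ ≤ 4 * (m * n) * ((9 * m) * (9 * n)) := by gcongr
    _ = 324 * (m ^ 2 * n ^ 2) := by ring

/-! ### Differences with many representations -/

/-- The elements of `B` representing `x` as a difference of an element of `A` and one of `B`. -/
noncomputable def diffFiber (A B : Finset ℝ) (x : ℝ) : Finset ℝ := B.filter fun b => x + b ∈ A

theorem mem_diffFiber {A B : Finset ℝ} {x b : ℝ} : b ∈ diffFiber A B x ↔ b ∈ B ∧ x + b ∈ A :=
  Finset.mem_filter

theorem card_diffFiber_le_left (A B : Finset ℝ) (x : ℝ) : (diffFiber A B x).card ≤ A.card :=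
  Finset.card_le_card_of_injOn (fun b => x + b) (fun _ hb => (mem_diffFiber.1 hb).2)
    fun _ _ _ _ h => add_left_cancel h

theorem sum_card_diffFiber (A B : Finset ℝ) :
    ∑ x ∈ A - B, (diffFiber A B x).card = A.card * B.card := by
  rw [← Finset.card_product, Finset.card_eq_sum_card_fiberwise (f := fun p => p.1 - p.2)
    (s := A ×ˢ B) (t := A - B)]
  · refine Finset.sum_congr rfl fun x _ => ?_
    refine Finset.card_bij' (fun b _ => (x + b, b)) (fun p _ => p.2) ?_ ?_ ?_ ?_
    · intro b hb
      have := mem_diffFiber.1 hb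
      simp [this.1, this.2]
    · rintro ⟨a, b⟩ h
      simp only [Finset.mem_filter, Finset.mem_product] at h
      obtain ⟨⟨ha, hb⟩, rfl⟩ := h
      simp [mem_diffFiber, ha, hb]
    · intro b _
      rfl
    · rintro ⟨a, b⟩ h
      simp only [Finset.mem_filter, Finset.mem_product] at h
      obtain ⟨-, rfl⟩ := h
      simp
  · rintro ⟨a, b⟩ h
    simp only [Finset.mem_coe, Finset.mem_product] at h
    exact Finset.sub_mem_sub h.1 h.2

/-- The differences with at least `t` representations. -/
noncomputable def richDiffs (A B : Finset ℝ) (t : ℕ) : Finset ℝ :=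
  (A - B).filter fun x => t ≤ (diffFiber A B x).card

theorem card_le_card_mul_self {A : Finset ℝ} (hA : (0 : ℝ) ∉ A) : A.card ≤ (A * A).card := by
  rcases A.eq_empty_or_nonempty with rfl | ⟨a, ha⟩
  · simp
  have h0 : a ≠ 0 := fun h => hA (h ▸ ha)
  exact Finset.card_le_card_of_injOn (fun x => a * x) (fun x hx => Finset.mul_mem_mul ha hx)
    fun _ _ _ _ h => mul_left_cancel₀ h0 h

theorem card_mul_richDiffs_le (A B : Finset ℝ) (t : ℕ) :
    (richDiffs A B t).card * t ≤ A.card * B.card := by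
  rw [← sum_card_diffFiber]
  calc (richDiffs A B t).card * t ≤ ∑ x ∈ richDiffs A B t, (diffFiber A B x).card := by
        rw [← smul_eq_mul]
        exact Finset.card_nsmul_le_sum _ _ _ fun x hx => (Finset.mem_filter.1 hx).2
    _ ≤ _ := Finset.sum_le_sum_of_subset (Finset.filter_subset _ _)

/-- If x + b lies in A, then for each c in A the line y = cu + cx passes through (b, c(x + b)) in B
× AA. So a rich x gives |A| rich lines. -/
theorem card_richDiffs_mul_cube_le {A : Finset ℝ} (hA : (0 : ℝ) ∉ A) (B : Finset ℝ) (t : ℕ) :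
    A.card * (richDiffs A B t).card * t ^ 3 ≤ 324 * (B.card ^ 2 * (A * A).card ^ 2) := by
  -- The incidence bound needs t ≥ 2; for smaller t, counting pairs suffices.
  rcases Nat.lt_or_ge t 2 with ht | ht
  · have h1 := card_mul_richDiffs_le A B t
    have h2 := card_le_card_mul_self hA
    have h3 : t ^ 2 ≤ 1 := pow_le_one₀ (Nat.zero_le _) (by omega)
    have h4 : B.card ≤ B.card ^ 2 := Nat.le_self_pow (by norm_num) _
    calc A.card * (richDiffs A B t).card * t ^ 3
        = A.card * ((richDiffs A B t).card * t) * t ^ 2 := by ring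
      _ ≤ A.card * (A.card * B.card) * 1 := by gcongr
      _ = B.card * A.card ^ 2 := by ring
      _ ≤ B.card ^ 2 * (A * A).card ^ 2 := by gcongr
      _ ≤ _ := Nat.le_mul_of_pos_left _ (by norm_num)
  · have hinj : Set.InjOn (fun p : ℝ × ℝ => (p.1, p.1 * p.2))
        (A ×ˢ richDiffs A B t : Finset (ℝ × ℝ)) := by
      rintro ⟨c, x⟩ h ⟨c', x'⟩ - heq
      simp only [Prod.mk.injEq] at heq
      obtain ⟨rfl, h2⟩ := heq
      have hc : c ≠ 0 := fun h0 => hA (h0 ▸ (Finset.mem_product.1 (Finset.mem_coe.1 h)).1)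
      rw [mul_left_cancel₀ hc h2]
    rw [← Finset.card_product, ← Finset.card_image_of_injOn hinj]
    refine card_rich_lines_le B (A * A) _ ht ?_ ?_
    · intro l hl
      obtain ⟨⟨c, x⟩, h, rfl⟩ := Finset.mem_image.1 hl
      exact fun h0 => hA (h0 ▸ (Finset.mem_product.1 h).1)
    · intro l hl
      obtain ⟨⟨c, x⟩, h, rfl⟩ := Finset.mem_image.1 hl
      obtain ⟨hc, hx⟩ := Finset.mem_product.1 h
      refine (Finset.mem_filter.1 hx).2.trans (Finset.card_le_card ?_)
      refine Finset.monotone_filter_right B fun b _ hb => ?_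
      change c * b + c * x ∈ A * A
      rw [show c * b + c * x = c * (x + b) by ring]
      exact Finset.mul_mem_mul hc hb

theorem card_sq_mul_card_mul_le {A : Finset ℝ} (hA : (0 : ℝ) ∉ A) (hA2 : 2 ≤ A.card) :
    A.card ^ 2 * (A * A).card ≤ 324 * (A * A - A * A).card ^ 2 := by
  have hinj : Set.InjOn (fun p : ℝ × ℝ => (p.1, -p.2)) (A ×ˢ (A * A) : Finset (ℝ × ℝ)) := by
    rintro ⟨c, x⟩ - ⟨c', x'⟩ - heq
    simpa using heq
  have h := card_rich_lines_le A (A * A - A * A)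
    ((A ×ˢ (A * A)).image fun p : ℝ × ℝ => (p.1, -p.2)) hA2 ?_ ?_
  · rw [Finset.card_image_of_injOn hinj, Finset.card_product] at h
    have h2 : A.card ^ 2 * (A.card ^ 2 * (A * A).card) ≤
        A.card ^ 2 * (324 * (A * A - A * A).card ^ 2) := by
      calc _ = A.card * (A * A).card * A.card ^ 3 := by ring
        _ ≤ _ := h
        _ = _ := by ring
    exact Nat.le_of_mul_le_mul_left h2 (by positivity)
  · intro l hl
    obtain ⟨⟨c, x⟩, h, rfl⟩ := Finset.mem_image.1 hl
    exact fun h0 => hA (h0 ▸ (Finset.mem_product.1 h).1)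
  · intro l hl
    obtain ⟨⟨c, x⟩, h, rfl⟩ := Finset.mem_image.1 hl
    obtain ⟨hc, hx⟩ := Finset.mem_product.1 h
    rw [Finset.filter_true_of_mem]
    intro u hu
    change c * u + -x ∈ _
    rw [← sub_eq_add_neg]
    exact Finset.sub_mem_sub (Finset.mul_mem_mul hc hu) hx

/-! ### Energy bounds -/

theorem succ_pow_succ_le (r k : ℕ) : (r + 1) ^ (k + 1) ≤ r ^ (k + 1) + (k + 1) * (r + 1) ^ k := by
  induction k with
  | zero => simp
  | succ k ih =>
    calc (r + 1) ^ (k + 2) = r * (r + 1) ^ (k + 1) + (r + 1) ^ (k + 1) := by ring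
      _ ≤ r * (r ^ (k + 1) + (k + 1) * (r + 1) ^ k) + (r + 1) ^ (k + 1) := by gcongr
      _ = r ^ (k + 2) + (k + 1) * (r * (r + 1) ^ k) + (r + 1) ^ (k + 1) := by ring
      _ ≤ r ^ (k + 2) + (k + 1) * ((r + 1) * (r + 1) ^ k) + (r + 1) ^ (k + 1) := by
        gcongr
        omega
      _ = r ^ (k + 2) + (k + 1 + 1) * (r + 1) ^ (k + 1) := by ring

/-- Layer-cake summation: r^(k+1) is at most (k+1) times the sum of t^k over 1 ≤ t ≤ r. -/
theorem sum_pow_card_diffFiber_le (A B : Finset ℝ) (k : ℕ) :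
    ∑ x ∈ A - B, (diffFiber A B x).card ^ (k + 1) ≤
      (k + 1) * ∑ t ∈ Finset.Icc 1 A.card, t ^ k * (richDiffs A B t).card := by
  have hpow : ∀ r : ℕ, r ^ (k + 1) ≤ (k + 1) * ∑ t ∈ Finset.Icc 1 r, t ^ k := by
    intro r
    induction r with
    | zero => simp
    | succ r ih =>
      rw [Finset.sum_Icc_succ_top (by omega), mul_add]
      exact (succ_pow_succ_le r k).trans (Nat.add_le_add_right ih _)
  calc ∑ x ∈ A - B, (diffFiber A B x).card ^ (k + 1)
      ≤ ∑ x ∈ A - B, (k + 1) * ∑ t ∈ Finset.Icc 1 A.card,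
          if t ≤ (diffFiber A B x).card then t ^ k else 0 := by
        refine Finset.sum_le_sum fun x _ => (hpow _).trans (Nat.mul_le_mul_left _ ?_)
        rw [← Finset.sum_filter]
        refine Finset.sum_le_sum_of_subset fun t ht => ?_
        have := card_diffFiber_le_left A B x
        simp only [Finset.mem_Icc, Finset.mem_filter] at ht ⊢
        omega
    _ = (k + 1) * ∑ t ∈ Finset.Icc 1 A.card, t ^ k * (richDiffs A B t).card := by
        rw [← Finset.mul_sum, Finset.sum_comm]
        congr 1
        refine Finset.sum_congr rfl fun t _ => ?_
        rw [← Finset.sum_filter, Finset.sum_const, smul_eq_mul, mul_comm]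
        rfl

/-- The third energy of `A`. -/
theorem sum_cube_card_diffFiber_le {A : Finset ℝ} (hA : (0 : ℝ) ∉ A) :
    (∑ x ∈ A - A, ((diffFiber A A x).card : ℝ) ^ 3) ≤
      972 * A.card * (A * A).card ^ 2 * (1 + Real.log A.card) := by
  rcases A.eq_empty_or_nonempty with rfl | hne
  · simp
  have hpos : (0 : ℝ) < A.card := by exact_mod_cast hne.card_pos
  have h := sum_pow_card_diffFiber_le A A 2
  have hR : (∑ x ∈ A - A, ((diffFiber A A x).card : ℝ) ^ 3) ≤
      3 * ∑ t ∈ Finset.Icc 1 A.card, (t : ℝ) ^ 2 * (richDiffs A A t).card := by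
    exact_mod_cast h
  -- The cubic decay leaves exactly 1/t; its harmonic sum is the source of the logarithm.
  have hterm : ∀ t ∈ Finset.Icc 1 A.card, (t : ℝ) ^ 2 * (richDiffs A A t).card ≤
      324 * A.card * (A * A).card ^ 2 * (t : ℝ)⁻¹ := by
    intro t ht
    have ht0 : (0 : ℝ) < t := by exact_mod_cast (Finset.mem_Icc.1 ht).1
    have h1 : (A.card : ℝ) * (richDiffs A A t).card * t ^ 3 ≤
        324 * (A.card ^ 2 * (A * A).card ^ 2) := by
      exact_mod_cast card_richDiffs_mul_cube_le hA A t
    rw [← div_eq_mul_inv, le_div_iff₀ ht0]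
    refine le_of_mul_le_mul_left ?_ hpos
    linarith
  have hharm : ∑ t ∈ Finset.Icc 1 A.card, (t : ℝ)⁻¹ ≤ 1 + Real.log A.card := by
    have := harmonic_le_one_add_log A.card
    rw [harmonic_eq_sum_Icc] at this
    push_cast at this
    exact this
  calc _ ≤ _ := hR
    _ ≤ 3 * ∑ t ∈ Finset.Icc 1 A.card, 324 * A.card * (A * A).card ^ 2 * (t : ℝ)⁻¹ := by
        gcongr 3 * ?_
        exact Finset.sum_le_sum hterm
    _ = 972 * A.card * (A * A).card ^ 2 * ∑ t ∈ Finset.Icc 1 A.card, (t : ℝ)⁻¹ := by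
        rw [← Finset.mul_sum]
        ring
    _ ≤ _ := by gcongr

/-- Split at Δ = √(Y/X), where the two bounds agree; each side then contributes O(√(XY)). -/
theorem sum_min_div_sq_le {X Y : ℝ} (hX : 0 < X) (hY : 0 ≤ Y) (n : ℕ) :
    ∑ t ∈ Finset.Icc 1 n, min X (Y / (t : ℝ) ^ 2) ≤ 3 * √(X * Y) := by
  set Δ := √(Y / X)
  have hXΔ : X * Δ = √(X * Y) := by
    have : X * Y = X ^ 2 * (Y / X) := by field_simp
    rw [this, Real.sqrt_mul (sq_nonneg X), Real.sqrt_sq hX.le]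
  have hYΔ : Y = √(X * Y) * Δ := by
    rw [← hXΔ, mul_assoc, Real.mul_self_sqrt (by positivity)]
    field_simp
  set k := ⌊Δ⌋₊
  have hk : (k : ℝ) ≤ Δ := Nat.floor_le (Real.sqrt_nonneg _)
  have hk' : Δ < k + 1 := Nat.lt_floor_add_one Δ
  have hsub : Finset.Icc 1 n ⊆ Finset.Icc 1 k ∪ Finset.Ioo k (n + 1) := by
    intro t ht
    simp only [Finset.mem_Icc, Finset.mem_union, Finset.mem_Ioo] at ht ⊢
    omega
  have hnn : ∀ t : ℕ, 0 ≤ min X (Y / (t : ℝ) ^ 2) := fun t => le_min hX.le (by positivity)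
  have hdisj : Disjoint (Finset.Icc 1 k) (Finset.Ioo k (n + 1)) := by
    rw [Finset.disjoint_left]
    intro t ht ht'
    simp only [Finset.mem_Icc, Finset.mem_Ioo] at ht ht'
    omega
  have h1 : ∑ t ∈ Finset.Icc 1 k, min X (Y / (t : ℝ) ^ 2) ≤ √(X * Y) := by
    calc _ ≤ ∑ t ∈ Finset.Icc 1 k, X := Finset.sum_le_sum fun t _ => min_le_left _ _
      _ = X * k := by simp [mul_comm]
      _ ≤ X * Δ := by gcongr
      _ = _ := hXΔ
  have h2 : ∑ t ∈ Finset.Ioo k (n + 1), min X (Y / (t : ℝ) ^ 2) ≤ 2 * √(X * Y) := by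
    calc _ ≤ ∑ t ∈ Finset.Ioo k (n + 1), Y * ((t : ℝ) ^ 2)⁻¹ :=
          Finset.sum_le_sum fun t _ => min_le_right _ _
      _ = Y * ∑ t ∈ Finset.Ioo k (n + 1), ((t : ℝ) ^ 2)⁻¹ := by rw [Finset.mul_sum]
      _ ≤ Y * (2 / (k + 1)) := by gcongr; exact sum_Ioo_inv_sq_le k (n + 1)
      _ = √(X * Y) * Δ * (2 / (k + 1)) := by rw [← hYΔ]
      _ ≤ √(X * Y) * (k + 1) * (2 / (k + 1)) := by gcongr
      _ = 2 * √(X * Y) := by field_simp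
  calc _ ≤ _ := Finset.sum_le_sum_of_subset_of_nonneg hsub fun t _ _ => hnn t
    _ = _ := Finset.sum_union hdisj
    _ ≤ 3 * √(X * Y) := by linarith

/-- The additive energy of `A` and `B`. -/
theorem sum_sq_card_diffFiber_sq_le {A : Finset ℝ} (hA : (0 : ℝ) ∉ A) (B : Finset ℝ) :
    (∑ x ∈ A - B, ((diffFiber A B x).card : ℝ) ^ 2) ^ 2 ≤
      11664 * B.card ^ 3 * (A * A).card ^ 2 := by
  rcases A.eq_empty_or_nonempty with rfl | hne
  · simp
  rcases B.eq_empty_or_nonempty with rfl | hneB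
  · simp
  have hpos : (0 : ℝ) < A.card := by exact_mod_cast hne.card_pos
  have hposB : (0 : ℝ) < B.card := by exact_mod_cast hneB.card_pos
  have hR : (∑ x ∈ A - B, ((diffFiber A B x).card : ℝ) ^ 2) ≤
      2 * ∑ t ∈ Finset.Icc 1 A.card, (t : ℝ) * (richDiffs A B t).card := by
    have h := sum_pow_card_diffFiber_le A B 1
    simp only [pow_one] at h
    exact_mod_cast h
  set X : ℝ := A.card * B.card with hX
  set Y : ℝ := 324 * (B.card ^ 2 * (A * A).card ^ 2) / A.card with hY
  -- Pair counting is used for small t, incidences for large t; no logarithm is lost.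
  have hterm : ∀ t ∈ Finset.Icc 1 A.card, (t : ℝ) * (richDiffs A B t).card ≤
      min X (Y / (t : ℝ) ^ 2) := by
    intro t ht
    have ht0 : (0 : ℝ) < t := by exact_mod_cast (Finset.mem_Icc.1 ht).1
    refine le_min ?_ ?_
    · rw [mul_comm, hX]
      exact_mod_cast card_mul_richDiffs_le A B t
    · have h1 : (A.card : ℝ) * (richDiffs A B t).card * t ^ 3 ≤
          324 * (B.card ^ 2 * (A * A).card ^ 2) := by
        exact_mod_cast card_richDiffs_mul_cube_le hA B t
      rw [le_div_iff₀ (by positivity), hY, le_div_iff₀ hpos]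
      linarith
  have h6 : (∑ x ∈ A - B, ((diffFiber A B x).card : ℝ) ^ 2) ≤ 6 * √(X * Y) := by
    have := (Finset.sum_le_sum hterm).trans
      (sum_min_div_sq_le (X := X) (Y := Y) (by positivity) (by positivity) A.card)
    linarith
  have h0 : (0 : ℝ) ≤ ∑ x ∈ A - B, ((diffFiber A B x).card : ℝ) ^ 2 :=
    Finset.sum_nonneg fun _ _ => sq_nonneg _
  refine (pow_le_pow_left₀ h0 h6 2).trans_eq ?_
  rw [mul_pow, Real.sq_sqrt (by positivity), hX, hY]
  field_simp
  norm_num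

/-! ### The Schoen–Shkredov inequality -/

/-- With A_s = A ∩ (A - s), the set A_s - A lies in both A - A and its translate by -s; apply
Cauchy–Schwarz to the representations of its elements. -/
theorem card_sq_mul_card_diffFiber_sq_le (A : Finset ℝ) (s : ℝ) :
    (diffFiber A A s).card ^ 2 * A.card ^ 2 ≤
      (diffFiber (A - A) (A - A) s).card * Finset.addEnergy (diffFiber A A s) (-A) := by
  have h := Finset.card_sq_le_card_mul_addEnergy (diffFiber A A s) (-A)
    (diffFiber (A - A) (A - A) s)
  rw [Finset.filter_true_of_mem, Finset.card_product, Finset.card_neg, mul_pow] at h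
  · exact h
  · rintro ⟨x, a⟩ hxa
    obtain ⟨hx, ha⟩ := Finset.mem_product.1 hxa
    obtain ⟨hx1, hx2⟩ := mem_diffFiber.1 hx
    have ha' : -a ∈ A := Finset.mem_neg'.1 ha
    refine mem_diffFiber.2 ⟨?_, ?_⟩
    · simpa using Finset.sub_mem_sub hx1 ha'
    · have := Finset.sub_mem_sub hx2 ha'
      rwa [sub_neg_eq_add, add_assoc] at this

/-- A solution x + a = x' + a' with x, x' in A_s gives three pairs in A with common difference u = x
- x': (x, x'), (x + s, x' + s), (-a, -a'). -/
theorem sum_addEnergy_diffFiber_le (A : Finset ℝ) :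
    ∑ s ∈ A - A, Finset.addEnergy (diffFiber A A s) (-A) ≤
      ∑ u ∈ A - A, (diffFiber A A u).card ^ 3 := by
  have h : ∀ u, (diffFiber A A u).card ^ 3 =
      (diffFiber A A u ×ˢ (diffFiber A A u ×ˢ diffFiber A A u)).card := by
    intro u
    rw [Finset.card_product, Finset.card_product]
    ring
  simp only [h, Finset.addEnergy]
  rw [← Finset.card_sigma, ← Finset.card_sigma]
  refine Finset.card_le_card_of_injOn
    (fun q => ⟨q.2.1.1 - q.2.1.2, (q.2.1.2, q.2.1.2 + q.1, -q.2.2.2)⟩) ?_ ?_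
  · rintro ⟨s, ⟨x, x'⟩, ⟨a, a'⟩⟩ hq
    simp only [Finset.mem_coe, Finset.mem_sigma, Finset.mem_filter, Finset.mem_product,
      mem_diffFiber, Finset.mem_neg'] at hq ⊢
    obtain ⟨-, ⟨⟨⟨hx, hxs⟩, ⟨hx', hxs'⟩⟩, ha, ha'⟩, he⟩ := hq
    refine ⟨Finset.sub_mem_sub hx hx', ⟨hx', ?_⟩, ⟨?_, ?_⟩, ha', ?_⟩
    · convert hx using 1; ring
    · convert hxs' using 1; ring
    · convert hxs using 1; ring
    · convert ha using 1; linarith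
  · rintro ⟨s, ⟨x, x'⟩, ⟨a, a'⟩⟩ hq ⟨t, ⟨y, y'⟩, ⟨b, b'⟩⟩ hr heq
    simp only [Finset.mem_coe, Finset.mem_sigma, Finset.mem_filter] at hq hr
    simp only [Sigma.mk.injEq, Prod.mk.injEq, heq_eq_eq] at heq
    obtain ⟨h1, h2, h3, h4⟩ := heq
    have e1 := hq.2.2
    have e2 := hr.2.2
    obtain rfl : x' = y' := h2
    obtain rfl : s = t := by linarith
    obtain rfl : x = y := by linarith
    obtain rfl : a = b := by linarith
    obtain rfl : a' = b' := by linarith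
    rfl

/-- Regroup (x + s) - x = (e + s) - e as x - e = (x + s) - (e + s). -/
theorem sum_card_mul_card_diffFiber_le (A D : Finset ℝ) :
    ∑ s ∈ A - A, (diffFiber A A s).card * (diffFiber D D s).card ≤
      ∑ z ∈ A - D, (diffFiber A D z).card ^ 2 := by
  simp only [sq, ← Finset.card_product]
  rw [← Finset.card_sigma, ← Finset.card_sigma]
  refine Finset.card_le_card_of_injOn
    (fun q => ⟨q.2.1 - q.2.2, (q.2.2, q.1 + q.2.2)⟩) ?_ ?_
  · rintro ⟨s, x, e⟩ hq
    simp only [Finset.mem_coe, Finset.mem_sigma, Finset.mem_product, mem_diffFiber] at hq ⊢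
    obtain ⟨-, ⟨hx, hxs⟩, he, hes⟩ := hq
    refine ⟨Finset.sub_mem_sub hx he, ⟨he, ?_⟩, hes, ?_⟩
    · convert hx using 1; ring
    · convert hxs using 1; ring
  · rintro ⟨s, x, e⟩ - ⟨t, y, f⟩ - heq
    simp only [Sigma.mk.injEq, Prod.mk.injEq, heq_eq_eq] at heq
    obtain ⟨h1, h2, h3⟩ := heq
    obtain rfl : e = f := h2
    obtain rfl : s = t := by linarith
    obtain rfl : x = y := by linarith
    rfl

/-- Cauchy–Schwarz restricted to the indices at which `r` is at least half its average. -/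
theorem pow_eight_le_of_sum_eq_sq {ι : Type*} {D : Finset ι} (hD : D.Nonempty) {N : ℝ} (hN : 0 < N)
    {r d E : ι → ℝ} (hr0 : ∀ s, 0 ≤ r s) (hd0 : ∀ s, 0 ≤ d s) (hE0 : ∀ s, 0 ≤ E s)
    (htotal : ∑ s ∈ D, r s = N ^ 2) (hrd : ∀ s, r s ^ 2 * N ^ 2 ≤ d s * E s) :
    N ^ 8 ≤ 8 * D.card * (∑ s ∈ D, E s) * ∑ s ∈ D, r s * d s := by
  classical
  have hDpos : (0 : ℝ) < D.card := by exact_mod_cast hD.card_pos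
  set P := D.filter fun s => N ^ 2 ≤ 2 * D.card * r s with hP
  have hPD : P ⊆ D := Finset.filter_subset _ _
  have hpop : N ^ 2 ≤ 2 * ∑ s ∈ P, r s := by
    have h1 := Finset.sum_filter_add_sum_filter_not D (fun s => N ^ 2 ≤ 2 * D.card * r s) r
    rw [htotal, ← hP] at h1
    have h2 : ∑ s ∈ D.filter (fun s => ¬ N ^ 2 ≤ 2 * D.card * r s), r s ≤
        D.card * (N ^ 2 / (2 * D.card)) := by
      calc _ ≤ (D.filter (fun s => ¬ N ^ 2 ≤ 2 * D.card * r s)).card • (N ^ 2 / (2 * D.card)) := by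
            refine Finset.sum_le_card_nsmul _ _ _ fun s hs => ?_
            have := (Finset.mem_filter.1 hs).2
            rw [le_div_iff₀ (by positivity)]
            linarith
        _ ≤ D.card • (N ^ 2 / (2 * D.card)) :=
            nsmul_le_nsmul_left (by positivity) (Finset.card_le_card (Finset.filter_subset _ _))
        _ = _ := nsmul_eq_mul _ _
    have h3 : D.card * (N ^ 2 / (2 * D.card)) = N ^ 2 / 2 := by field_simp
    linarith
  have hCS : (∑ s ∈ P, r s * N) ^ 2 ≤ (∑ s ∈ P, d s) * ∑ s ∈ P, E s :=
    Finset.sum_sq_le_sum_mul_sum_of_sq_le_mul P (fun s _ => hd0 s) (fun s _ => hE0 s)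
      fun s _ => by rw [mul_pow]; exact hrd s
  have hEsum : ∑ s ∈ P, E s ≤ ∑ s ∈ D, E s :=
    Finset.sum_le_sum_of_subset_of_nonneg hPD fun s _ _ => hE0 s
  -- On P the weight r is at least N²/(2|D|), so it can be inserted at the cost of a factor 2|D|/N².
  have hdsum : N ^ 2 * ∑ s ∈ P, d s ≤ 2 * D.card * ∑ s ∈ D, r s * d s := by
    calc N ^ 2 * ∑ s ∈ P, d s ≤ ∑ s ∈ P, 2 * D.card * (r s * d s) := by
          rw [Finset.mul_sum]
          refine Finset.sum_le_sum fun s hs => ?_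
          rw [← mul_assoc]
          exact mul_le_mul_of_nonneg_right (Finset.mem_filter.1 hs).2 (hd0 s)
      _ ≤ ∑ s ∈ D, 2 * D.card * (r s * d s) :=
          Finset.sum_le_sum_of_subset_of_nonneg hPD fun s _ _ =>
            mul_nonneg (by positivity) (mul_nonneg (hr0 s) (hd0 s))
      _ = 2 * D.card * ∑ s ∈ D, r s * d s := by rw [Finset.mul_sum]
  have hd0' : 0 ≤ ∑ s ∈ P, d s := Finset.sum_nonneg fun s _ => hd0 s
  have hE0' : 0 ≤ ∑ s ∈ D, E s := Finset.sum_nonneg fun s _ => hE0 s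
  rw [← Finset.sum_mul] at hCS
  have h1 : (N ^ 2 * N) ^ 2 ≤ (2 * (∑ s ∈ P, r s) * N) ^ 2 := by gcongr
  calc N ^ 8 = N ^ 2 * (N ^ 2 * N) ^ 2 := by ring
    _ ≤ N ^ 2 * (4 * ((∑ s ∈ P, d s) * ∑ s ∈ D, E s)) := by
        refine mul_le_mul_of_nonneg_left ?_ (by positivity)
        have := mul_le_mul_of_nonneg_left hEsum hd0'
        linarith
    _ = 4 * (∑ s ∈ D, E s) * (N ^ 2 * ∑ s ∈ P, d s) := by ring
    _ ≤ 4 * (∑ s ∈ D, E s) * (2 * D.card * ∑ s ∈ D, r s * d s) :=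
        mul_le_mul_of_nonneg_left hdsum (by positivity)
    _ = _ := by ring

/-- The Schoen–Shkredov inequality relating the difference set to the third energy. -/
theorem card_pow_eight_le (A : Finset ℝ) :
    (A.card : ℝ) ^ 8 ≤ 8 * (A - A).card * (∑ u ∈ A - A, ((diffFiber A A u).card : ℝ) ^ 3) *
      ∑ z ∈ A - (A - A), ((diffFiber A (A - A) z).card : ℝ) ^ 2 := by
  rcases A.eq_empty_or_nonempty with rfl | hne
  · simp
  have hE : ∑ s ∈ A - A, (Finset.addEnergy (diffFiber A A s) (-A) : ℝ) ≤
      ∑ u ∈ A - A, ((diffFiber A A u).card : ℝ) ^ 3 := by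
    exact_mod_cast sum_addEnergy_diffFiber_le A
  have hd : ∑ s ∈ A - A, ((diffFiber A A s).card : ℝ) * (diffFiber (A - A) (A - A) s).card ≤
      ∑ z ∈ A - (A - A), ((diffFiber A (A - A) z).card : ℝ) ^ 2 := by
    exact_mod_cast sum_card_mul_card_diffFiber_le A (A - A)
  refine (pow_eight_le_of_sum_eq_sq (hne.sub hne) (N := (A.card : ℝ))
    (by exact_mod_cast hne.card_pos) (fun s => Nat.cast_nonneg _) (fun s => Nat.cast_nonneg _)
    (fun s => Nat.cast_nonneg _) ?_
    fun s => by exact_mod_cast card_sq_mul_card_diffFiber_sq_le A s).trans ?_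
  · rw [sq]
    exact_mod_cast sum_card_diffFiber A A
  · refine mul_le_mul (mul_le_mul_of_nonneg_left hE (by positivity)) hd ?_ ?_
    · exact Finset.sum_nonneg fun s _ => by positivity
    · exact mul_nonneg (by positivity) (Finset.sum_nonneg fun s _ => by positivity)

/-! ### Combining the inequalities -/

theorem card_sub_self_le {A : Finset ℝ} (hA : (0 : ℝ) ∉ A) :
    (A - A).card ≤ (A * A - A * A).card := by
  rcases A.eq_empty_or_nonempty with rfl | ⟨a, ha⟩
  · simp
  have h0 : a ≠ 0 := fun h => hA (h ▸ ha)
  refine Finset.card_le_card_of_injOn (fun x => a * x) ?_ fun _ _ _ _ h => mul_left_cancel₀ h0 h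
  intro x hx
  obtain ⟨b, hb, c, hc, rfl⟩ := Finset.mem_sub.1 (Finset.mem_coe.1 hx)
  change a * (b - c) ∈ A * A - A * A
  rw [mul_sub]
  exact Finset.sub_mem_sub (Finset.mul_mem_mul ha hb) (Finset.mul_mem_mul ha hc)

theorem card_pow_fourteen_le {A : Finset ℝ} (hA : (0 : ℝ) ∉ A) (hne : A.Nonempty) :
    (A.card : ℝ) ^ 14 ≤ 64 * 972 ^ 2 * 11664 * ((A - A).card : ℝ) ^ 5 * (A * A).card ^ 6 *
      (1 + Real.log A.card) ^ 2 := by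
  have hN : (0 : ℝ) < A.card := by exact_mod_cast hne.card_pos
  have h8 := card_pow_eight_le A
  have h3 := sum_cube_card_diffFiber_le hA
  have h2 := sum_sq_card_diffFiber_sq_le hA (A - A)
  have hE₃ : 0 ≤ ∑ u ∈ A - A, ((diffFiber A A u).card : ℝ) ^ 3 :=
    Finset.sum_nonneg fun s _ => by positivity
  set E₃ := ∑ u ∈ A - A, ((diffFiber A A u).card : ℝ) ^ 3
  set E₂ := ∑ z ∈ A - (A - A), ((diffFiber A (A - A) z).card : ℝ) ^ 2
  set N : ℝ := (A.card : ℝ)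
  set M : ℝ := ((A * A).card : ℝ)
  set D : ℝ := ((A - A).card : ℝ)
  set l := 1 + Real.log N
  -- Squaring is forced by the energy bound on E₂²; the factor N² from E₃² then cancels.
  have h16 : N ^ 2 * N ^ 14 ≤ N ^ 2 * (64 * 972 ^ 2 * 11664 * D ^ 5 * M ^ 6 * l ^ 2) := by
    calc N ^ 2 * N ^ 14 = (N ^ 8) ^ 2 := by ring
      _ ≤ (8 * D * E₃ * E₂) ^ 2 := by gcongr
      _ = 64 * D ^ 2 * E₃ ^ 2 * E₂ ^ 2 := by ring
      _ ≤ 64 * D ^ 2 * (972 * N * M ^ 2 * l) ^ 2 * (11664 * D ^ 3 * M ^ 2) := by gcongr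
      _ = _ := by ring
  exact le_of_mul_le_mul_left h16 (by positivity)

theorem exists_card_pow_le : ∃ C : ℝ, 0 < C ∧ ∀ A : Finset ℝ, (0 : ℝ) ∉ A → 2 ≤ A.card →
    (A.card : ℝ) ^ 26 ≤ C * (A * A - A * A).card ^ 17 * Real.log A.card ^ 2 := by
  refine ⟨64 * 972 ^ 2 * 11664 * 324 ^ 6 * 3 ^ 2, by norm_num, fun A hA hA2 => ?_⟩
  have hne : A.Nonempty := Finset.card_pos.1 (by omega)
  have hN2 : (2 : ℝ) ≤ A.card := by exact_mod_cast hA2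
  have h14 := card_pow_fourteen_le hA hne
  have hprod : (A.card : ℝ) ^ 2 * (A * A).card ≤ 324 * (A * A - A * A).card ^ 2 := by
    exact_mod_cast card_sq_mul_card_mul_le hA hA2
  have hsub : ((A - A).card : ℝ) ≤ (A * A - A * A).card := by
    exact_mod_cast card_sub_self_le hA
  -- Since |A| ≥ 2, 1 ≤ 2 log 2 ≤ 2 log |A|.
  have hlog : 1 + Real.log A.card ≤ 3 * Real.log A.card := by
    have := Real.log_le_log (by norm_num) hN2
    have := Real.log_two_gt_d9
    linarith
  have hlog0 : 0 ≤ Real.log A.card := Real.log_nonneg (by linarith)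
  set N : ℝ := (A.card : ℝ)
  set M : ℝ := ((A * A).card : ℝ)
  set D : ℝ := ((A - A).card : ℝ)
  set D' : ℝ := ((A * A - A * A).card : ℝ)
  set l := Real.log N
  -- The factor N¹² completes M⁶ to (N²M)⁶.
  calc N ^ 26 = N ^ 12 * N ^ 14 := by ring
    _ ≤ N ^ 12 * (64 * 972 ^ 2 * 11664 * D ^ 5 * M ^ 6 * (1 + l) ^ 2) := by gcongr
    _ = 64 * 972 ^ 2 * 11664 * D ^ 5 * (N ^ 2 * M) ^ 6 * (1 + l) ^ 2 := by ring
    _ ≤ 64 * 972 ^ 2 * 11664 * D' ^ 5 * (324 * D' ^ 2) ^ 6 * (3 * l) ^ 2 := by gcongr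
    _ = _ := by ring

theorem theorem2p3 :
    ∃ c : ℝ, 0 < c ∧ ∀ A : Finset ℝ, (0 : ℝ) ∉ A → 2 ≤ A.card →
      c * ((A.card : ℝ) ^ (26 / 17 : ℝ) / (Real.log (A.card : ℝ)) ^ (2 / 17 : ℝ)) ≤
        ((A * A - A * A).card : ℝ) := by
  obtain ⟨C, hC, h⟩ := exists_card_pow_le
  refine ⟨(C ^ (1 / 17 : ℝ))⁻¹, by positivity, fun A hA hA2 => ?_⟩
  have hA' := h A hA hA2
  have hlog : 0 < Real.log A.card := Real.log_pos (by exact_mod_cast hA2)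
  have hroot := Real.rpow_le_rpow (by positivity) hA' (by norm_num : (0 : ℝ) ≤ 1 / 17)
  rw [Real.mul_rpow (by positivity) (by positivity), Real.mul_rpow hC.le (by positivity),
    ← Real.rpow_natCast, ← Real.rpow_natCast, ← Real.rpow_natCast,
    ← Real.rpow_mul (by positivity), ← Real.rpow_mul (by positivity),
    ← Real.rpow_mul hlog.le] at hroot
  norm_num at hroot
  rw [inv_mul_le_iff₀ (by positivity), div_le_iff₀ (by positivity)]
  norm_num
  exact hroot
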